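/- Fix integers $k\ge 2$ and $\ell\ge 0$. A graph $G$ is a finite, undirected, simple graph with $\ell$ unary vertex labels. The atomic type $\mathrm{atp}_k(G,\vec v)$ of $\vec v\in V(G)^k$ records, for $1\le i<j\le k$, whether $v_i=v_j$ and whether $v_iv_j\in E(G)$, and, for each $i$, which labels $v_i$ carries. Oblivious $k$-WL is the sequence of $k$-ary invariants with $\mathrm{owl}_k^{0}(G,\vec v)=\mathrm{atp}_k(G,\vec v)$ and $$\mathrm{owl}_k^{t+1}(G,\vec v)=\Big(\mathrm{owl}_k^{t}(G,\vec v),\{\!\!\{\mathrm{owl}_k^{t}(G,\vec v[w/1])\mid w\in V(G)\}\!\!\},\dots,\{\!\!\{\mathrm{owl}_k^{t}(G,\vec v[w/k])\mid w\in V(G)\}\!\!\}\Big),$$ where $\vec v[w/i]$ is $\vec v$ with its $i$th entry replaced by $w$. For $k$-ary invariants $\xi,\xi'$, we say that $\xi$ refines $\xi'$ (on a class of graphs) if for all graphs $G,G'$ (in the class) and all $\vec v\in V(G)^k$, $\vec v'\in V(G')^k$, $\xi(G,\vec v)=\xi(G',\vec v')$ implies $\xi'(G,\vec v)=\xi'(G',\vec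 v')$. Let $A_G$ be the structure with vertex set $V(G)^k$, binary relations $E_1,\dots,E_k$, where $E_i$ holds for two tuples that differ exactly in the $i$th entry, and one unary relation for each possible atomic type $\theta$, holding for the tuples of atomic type $\theta$. A GNN layer on $A_G$ of input dimension $p$ and output dimension $q$ maps a feature map $\zeta:V(G)^k\to\mathbb R^p$ to $$\eta(\vec v)=\mathrm{comb}\big(\zeta(\vec v),\mathrm{agg}(M_{\vec v})\big)\in\mathbb R^{q},$$ where the multiset $M_{\vec v}$ contains, for every $i\in\{1,\dots,k\}$, a message $\mathrm{msg}^{\mathrm{out}}_{i}(\zeta(\vec w))$ for every $\vec w$ with $(\vec v,\vec w)\in E_i$ and a message $\mathrm{msg}^{\mathrm{in}}_{i}(\zeta(\vec w))$ for every $\vec w$ with $(\vec w,\vec v)\in E_i$. A $d$-layer $k$-GNN consists of $d$ layers of matching dimensions and a readout function; a recurrent $k$-GNN consists of one layer with equal input and output dimension, applied repeatedly, and a readout function. The input dimension is at least the total number of relations of $A_G$. The initial feature of $\vec v$ is its $0$-$1$-vector $\mathrm{col}(A_G,\vec v)$, padded by zeros, where $\mathrm{col}(A_G,\vec v)$ has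 one entry for each binary relation (whether $(\vec v,\vec v)\in E_i$) and one for each unary relation (whether it holds for $\vec v$). The $k$-ary invariant computed by a $d$-layer $k$-GNN (by the $t$-th iteration of a recurrent $k$-GNN) is the readout function applied to the features after $d$ layers (after $t$ iterations). **Theorem.** 1. Let $d\ge 1$ and let $\xi$ be a $k$-ary invariant computed by a $d$-layer $k$-GNN, with arbitrary message, aggregation, combination and readout functions. Then $\mathrm{owl}_k^{d}$ refines $\xi$. 2. For every $n\ge 1$ there is a recurrent $k$-GNN such that for all $t\le n$ the $k$-ary invariant $\xi^{(t)}$ computed by its $t$-th iteration refines $\mathrm{owl}_k^{t}$ on all graphs of order at most $n$. Moreover, for every continuous non-polynomial $\sigma:\mathbb R\to\mathbb R$, this $k$-GNN can be chosen with linear message functions, summation as aggregation function, and combination and readout functions computed by feed-forward neural networks of depth $2$ with activation function $\sigma$ on the first layer and no activation function on the second. -/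

import Mathlib

universe u w

noncomputable section

/-! ### Labelled graphs, binary structures, invariants -/

/-- A simple undirected graph on `V` with `ℓ` vertex labels. -/
structure LabelledGraph (ℓ : ℕ) (V : Type u) where
  graph : SimpleGraph V
  label : Fin ℓ → V → Prop

/-- Isomorphisms of labelled graphs. -/
structure LabelledGraph.IsIso {ℓ : ℕ} {V V' : Type u} (G : LabelledGraph ℓ V)
    (G' : LabelledGraph ℓ V') (f : V ≃ V') : Prop where
  adj : ∀ v w, G.graph.Adj v w ↔ G'.graph.Adj (f v) (f w)
  label : ∀ i v, G.label i v ↔ G'.label i (f v)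

/-- A `k`-ary invariant (with range `Y`) of finite graphs with `ℓ` labels: an equivariant
assignment of a function `V(G)^k → Y` to every finite graph `G`. -/
structure TupleInvariant (k ℓ : ℕ) (Y : Type w) where
  toFun : ∀ {V : Type u} [Fintype V], LabelledGraph ℓ V → (Fin k → V) → Y
  equivariant : ∀ {V V' : Type u} [Fintype V] [Fintype V'] (G : LabelledGraph ℓ V)
    (G' : LabelledGraph ℓ V') (f : V ≃ V'), G.IsIso G' f →
    ∀ v : Fin k → V, toFun G v = toFun G' (fun i => f (v i))

/-- `ξ` refines `ξ'`: tuples (possibly of different graphs) with equal `ξ`-colours have equal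
`ξ'`-colours. -/
def TupleInvariant.Refines {k ℓ : ℕ} {Y Y' : Type*} (ξ : TupleInvariant.{u} k ℓ Y)
    (ξ' : TupleInvariant.{u} k ℓ Y') : Prop :=
  ∀ (V V' : Type u) [Fintype V] [Fintype V'] (G : LabelledGraph ℓ V) (G' : LabelledGraph ℓ V')
    (v : Fin k → V) (v' : Fin k → V'),
    ξ.toFun G v = ξ.toFun G' v' → ξ'.toFun G v = ξ'.toFun G' v'

/-- `ξ` refines `ξ'` on all graphs of order at most `n`. -/
def TupleInvariant.RefinesUpToOrder {k ℓ : ℕ} {Y Y' : Type*} (n : ℕ)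
    (ξ : TupleInvariant.{u} k ℓ Y) (ξ' : TupleInvariant.{u} k ℓ Y') : Prop :=
  ∀ (V V' : Type u) [Fintype V] [Fintype V'] (G : LabelledGraph ℓ V) (G' : LabelledGraph ℓ V')
    (v : Fin k → V) (v' : Fin k → V'), Fintype.card V ≤ n → Fintype.card V' ≤ n →
    ξ.toFun G v = ξ.toFun G' v' → ξ'.toFun G v = ξ'.toFun G' v'

/-! ### Atomic types and oblivious `k`-WL -/

/-- Atomic types of `k`-tuples: for `i < j` two bits (equality and adjacency), and for each entry
`ℓ` label bits. -/
abbrev AtomicType (k ℓ : ℕ) : Type :=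
  ({p : Fin k × Fin k // p.1 < p.2} → Bool × Bool) × (Fin k → Fin ℓ → Bool)

open Classical in
/-- The atomic type of the tuple `v` in `G`. -/
def LabelledGraph.atp {k ℓ : ℕ} {V : Type u} (G : LabelledGraph ℓ V) (v : Fin k → V) :
    AtomicType k ℓ :=
  (fun p => (decide (v p.1.1 = v p.1.2), decide (G.graph.Adj (v p.1.1) (v p.1.2))),
   fun i a => decide (G.label a (v i)))

/-- The colours used by oblivious `k`-WL in round `t`. -/
def OwlColour (k ℓ : ℕ) : ℕ → Type
  | 0 => AtomicType k ℓ
  | t + 1 => OwlColour k ℓ t × (Fin k → Multiset (OwlColour k ℓ t))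

/-- The colouring computed by `t` rounds of oblivious `k`-WL;
`Function.update v i w` is the tuple `v[w/i]`. -/
def LabelledGraph.owl {k ℓ : ℕ} {V : Type u} [Fintype V] (G : LabelledGraph ℓ V) :
    (t : ℕ) → (Fin k → V) → OwlColour k ℓ t
  | 0, v => G.atp v
  | t + 1, v => (G.owl t v,
      fun i => (Finset.univ : Finset V).val.map fun w => G.owl t (Function.update v i w))

theorem LabelledGraph.atp_equivariant {k ℓ : ℕ} {V V' : Type u} {G : LabelledGraph ℓ V}
    {G' : LabelledGraph ℓ V'} {f : V ≃ V'} (h : G.IsIso G' f) (v : Fin k → V) :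
    G.atp v = G'.atp (fun i => f (v i)) := by
  refine Prod.ext (funext fun p => Prod.ext ?_ ?_) (funext fun i => funext fun a => ?_)
  · exact decide_eq_decide.2 f.apply_eq_iff_eq.symm
  · exact decide_eq_decide.2 (h.adj _ _)
  · exact decide_eq_decide.2 (h.label _ _)

theorem LabelledGraph.owl_equivariant {k ℓ : ℕ} {V V' : Type u} [Fintype V] [Fintype V']
    {G : LabelledGraph ℓ V} {G' : LabelledGraph ℓ V'} {f : V ≃ V'} (h : G.IsIso G' f) (t : ℕ) :
    ∀ v : Fin k → V, G.owl t v = G'.owl t (fun i => f (v i)) := by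
  induction t with
  | zero => exact fun v => LabelledGraph.atp_equivariant h v
  | succ t ih =>
    intro v
    refine Prod.ext (ih v) (funext fun i => ?_)
    change (Finset.univ : Finset V).val.map _ = (Finset.univ : Finset V').val.map _
    rw [← Finset.map_univ_equiv f, Finset.map_val, Multiset.map_map]
    refine Multiset.map_congr rfl fun w _ => ?_
    rw [ih]
    refine congrArg _ (funext fun j => ?_)
    by_cases hj : j = i
    · subst hj; simp
    · simp [hj]

/-- `t` rounds of oblivious `k`-WL, as a `k`-ary invariant. -/
def owlInvariant (k ℓ t : ℕ) : TupleInvariant.{u} k ℓ (OwlColour k ℓ t) where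
  toFun G v := G.owl t v
  equivariant _ _ _ h v := LabelledGraph.owl_equivariant h t v

/-! ### Binary structures -/

/-- A structure on `X` with binary relations indexed by `R` and unary relations indexed by `U`. -/
structure BinaryStructure (R U : Type) (X : Type u) where
  rel : R → X → X → Prop
  lab : U → X → Prop

/-- Isomorphisms of binary structures. -/
structure BinaryStructure.IsIso {R U : Type} {X X' : Type u} (A : BinaryStructure R U X)
    (A' : BinaryStructure R U X') (f : X ≃ X') : Prop where
  rel : ∀ r x y, A.rel r x y ↔ A'.rel r (f x) (f y)
  lab : ∀ a x, A.lab a x ↔ A'.lab a (f x)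

open Classical in
/-- The colour of an element: a `0`-`1`-vector with an entry for every binary relation (does the
loop at `x` belong to it?) and an entry for every unary relation. -/
def BinaryStructure.col {R U : Type} {X : Type u} (A : BinaryStructure R U X) (x : X) :
    R ⊕ U → ℝ
  | Sum.inl r => if A.rel r x x then 1 else 0
  | Sum.inr a => if A.lab a x then 1 else 0

/-- The colour, written as a vector of dimension `q` (with respect to a fixed enumeration of the
relations) and padded by zeros. -/
def BinaryStructure.initialFeature {R U : Type} [Fintype R] [Fintype U] {X : Type u}
    (A : BinaryStructure R U X) (q : ℕ) (x : X) : Fin q → ℝ :=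
  fun i => if h : (i : ℕ) < Fintype.card (R ⊕ U) then
    A.col x ((Fintype.equivFin (R ⊕ U)).symm ⟨i, h⟩) else 0

/-- The binary structure `A_G` on `V(G)^k`: the relation `E_i` holds for two tuples that differ
exactly in the `i`-th entry, and the unary relations are given by the atomic types. -/
def LabelledGraph.tupleStructure {ℓ : ℕ} {V : Type u} (k : ℕ) (G : LabelledGraph ℓ V) :
    BinaryStructure (Fin k) (AtomicType k ℓ) (Fin k → V) where
  rel i v v' := v i ≠ v' i ∧ ∀ j, j ≠ i → v j = v' j
  lab θ v := G.atp v = θ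

theorem LabelledGraph.tupleStructure_isIso {k ℓ : ℕ} {V V' : Type u} {G : LabelledGraph ℓ V}
    {G' : LabelledGraph ℓ V'} {f : V ≃ V'} (h : G.IsIso G' f) :
    (G.tupleStructure k).IsIso (G'.tupleStructure k) (Equiv.arrowCongr (Equiv.refl (Fin k)) f) where
  rel r v v' := by simp [LabelledGraph.tupleStructure]
  lab θ v := by
    change G.atp v = θ ↔ G'.atp (fun i => f (v i)) = θ
    rw [LabelledGraph.atp_equivariant h]

/-! ### Graph neural networks on binary structures -/

/-- A GNN layer of input dimension `p` and output dimension `q` for binary structures with binary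
relations indexed by `R`: message functions, which depend on the relation and on the direction in
which an edge is traversed, an aggregation function and a combination function. -/
structure GNNLayer (R : Type) (p q : ℕ) where
  msgDim : ℕ
  aggDim : ℕ
  msgOut : R → (Fin p → ℝ) → (Fin msgDim → ℝ)
  msgIn : R → (Fin p → ℝ) → (Fin msgDim → ℝ)
  agg : Multiset (Fin msgDim → ℝ) → (Fin aggDim → ℝ)
  comb : (Fin (p + aggDim) → ℝ) → (Fin q → ℝ)

open Classical in
/-- The multiset of messages that the element `x` receives from its neighbours. -/
def GNNLayer.messages {R : Type} [Fintype R] {p q : ℕ} (L : GNNLayer R p q) {U : Type}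
    {X : Type u} [Fintype X] (A : BinaryStructure R U X) (ζ : X → Fin p → ℝ) (x : X) :
    Multiset (Fin L.msgDim → ℝ) :=
  ∑ r : R, ((Finset.univ.filter fun y => A.rel r x y).val.map (fun y => L.msgOut r (ζ y)) +
    (Finset.univ.filter fun y => A.rel r y x).val.map (fun y => L.msgIn r (ζ y)))

/-- The transformation of feature maps computed by a GNN layer. -/
def GNNLayer.apply {R : Type} [Fintype R] {p q : ℕ} (L : GNNLayer R p q) {U : Type}
    {X : Type u} [Fintype X] (A : BinaryStructure R U X) (ζ : X → Fin p → ℝ) :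
    X → Fin q → ℝ :=
  fun x => L.comb (Fin.append (ζ x) (L.agg (L.messages A ζ x)))

/-- A GNN with `d` layers for binary structures with binary relations indexed by `R` and unary
relations indexed by `U`, together with a readout function. -/
structure GNN (R U : Type) [Fintype R] [Fintype U] (d : ℕ) (Y : Type w) where
  dim : Fin (d + 1) → ℕ
  card_le_dim : Fintype.card (R ⊕ U) ≤ dim 0
  layer : ∀ i : Fin d, GNNLayer R (dim i.castSucc) (dim i.succ)
  readout : (Fin (dim (Fin.last d)) → ℝ) → Y

/-- The feature map computed by the first `t` layers of a GNN. -/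
def GNN.feature {R U : Type} [Fintype R] [Fintype U] {d : ℕ} {Y : Type w} (N : GNN R U d Y)
    {X : Type u} [Fintype X] (A : BinaryStructure R U X) (t : Fin (d + 1)) :
    X → Fin (N.dim t) → ℝ :=
  Fin.induction (motive := fun t => X → Fin (N.dim t) → ℝ)
    (A.initialFeature (N.dim 0)) (fun i ζ => (N.layer i).apply A ζ) t

/-- A recurrent GNN: a single layer, to be applied repeatedly, and a readout function. -/
structure RecurrentGNN (R U : Type) [Fintype R] [Fintype U] (Y : Type w) where
  dim : ℕ
  card_le_dim : Fintype.card (R ⊕ U) ≤ dim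
  layer : GNNLayer R dim dim
  readout : (Fin dim → ℝ) → Y

/-- The feature map computed in the `t`-th iteration of a recurrent GNN. -/
def RecurrentGNN.feature {R U : Type} [Fintype R] [Fintype U] {Y : Type w}
    (N : RecurrentGNN R U Y) {X : Type u} [Fintype X] (A : BinaryStructure R U X) :
    ℕ → X → Fin N.dim → ℝ
  | 0 => A.initialFeature N.dim
  | t + 1 => N.layer.apply A (N.feature A t)

theorem BinaryStructure.initialFeature_equivariant {R U : Type} [Fintype R] [Fintype U]
    {X X' : Type u} {A : BinaryStructure R U X} {A' : BinaryStructure R U X'} {f : X ≃ X'}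
    (h : A.IsIso A' f) (q : ℕ) (x : X) : A.initialFeature q x = A'.initialFeature q (f x) := by
  classical
  have hc : A.col x = A'.col (f x) := by
    funext c
    cases c with
    | inl r => exact if_congr (h.rel r x x) rfl rfl
    | inr a => exact if_congr (h.lab a x) rfl rfl
  funext i
  simp only [BinaryStructure.initialFeature, hc]

theorem GNNLayer.apply_equivariant {R : Type} [Fintype R] {p q : ℕ} (L : GNNLayer R p q)
    {U : Type} {X X' : Type u} [Fintype X] [Fintype X'] {A : BinaryStructure R U X}
    {A' : BinaryStructure R U X'} {f : X ≃ X'} (h : A.IsIso A' f) {ζ : X → Fin p → ℝ}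
    {ζ' : X' → Fin p → ℝ} (hζ : ∀ x, ζ x = ζ' (f x)) (x : X) :
    L.apply A ζ x = L.apply A' ζ' (f x) := by
  classical
  have hm : L.messages A ζ x = L.messages A' ζ' (f x) := by
    unfold GNNLayer.messages
    refine Finset.sum_congr rfl fun r _ => ?_
    rw [← Finset.map_univ_equiv f]
    simp only [Finset.filter_map, Finset.map_val, Multiset.map_map, Function.comp_def,
      Equiv.coe_toEmbedding, hζ]
    congr 3
    · exact Finset.filter_congr fun y _ => h.rel r x y
    · exact Finset.filter_congr fun y _ => h.rel r y x
  simp only [GNNLayer.apply, hm, hζ]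

/-- A `k`-GNN with `d` layers: a GNN operating on the structures `A_G`. -/
abbrev KGNN (k ℓ d : ℕ) (Y : Type w) := GNN (Fin k) (AtomicType k ℓ) d Y

/-- A recurrent `k`-GNN. -/
abbrev RecurrentKGNN (k ℓ : ℕ) (Y : Type w) := RecurrentGNN (Fin k) (AtomicType k ℓ) Y

/-- The `k`-ary invariant computed by a `k`-GNN with `d` layers. -/
def KGNN.invariant {k ℓ d : ℕ} {Y : Type w} (N : KGNN k ℓ d Y) : TupleInvariant.{u} k ℓ Y where
  toFun G v := N.readout (N.feature (G.tupleStructure k) (Fin.last d) v)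
  equivariant G G' f h v := by
    have hA := LabelledGraph.tupleStructure_isIso (k := k) h
    have key : ∀ (t : Fin (d + 1)) v, N.feature (G.tupleStructure k) t v =
        N.feature (G'.tupleStructure k) t (Equiv.arrowCongr (Equiv.refl (Fin k)) f v) := by
      intro t
      induction t using Fin.induction with
      | zero => exact fun v => BinaryStructure.initialFeature_equivariant hA _ v
      | succ i ih => exact fun v => (N.layer i).apply_equivariant hA ih v
    exact congrArg N.readout (key (Fin.last d) v)

/-- The `k`-ary invariant computed by the `t`-th iteration of a recurrent `k`-GNN. -/
def RecurrentKGNN.invariant {k ℓ : ℕ} {Y : Type w} (N : RecurrentKGNN k ℓ Y) (t : ℕ) :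
    TupleInvariant.{u} k ℓ Y where
  toFun G v := N.readout (N.feature (G.tupleStructure k) t v)
  equivariant G G' f h v := by
    have hA := LabelledGraph.tupleStructure_isIso (k := k) h
    have key : ∀ (t : ℕ) v, N.feature (G.tupleStructure k) t v =
        N.feature (G'.tupleStructure k) t (Equiv.arrowCongr (Equiv.refl (Fin k)) f v) := by
      intro t
      induction t with
      | zero => exact fun v => BinaryStructure.initialFeature_equivariant hA _ v
      | succ i ih => exact fun v => N.layer.apply_equivariant hA ih v
    exact congrArg N.readout (key t v)

/-! ### Layers represented by feed-forward neural networks -/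

/-- The function computed by an FNN layer with weight matrix `A`, bias `b` and activation `σ`. -/
def fnnLayer {m n : ℕ} (σ : ℝ → ℝ) (A : Matrix (Fin n) (Fin m) ℝ) (b : Fin n → ℝ)
    (x : Fin m → ℝ) : Fin n → ℝ :=
  fun i => σ ((A.mulVec x + b) i)

/-- `f` is computed by an FNN of depth 2 with activation function `σ` on the interior layer and no
activation function on the output layer. -/
def IsDepthTwoFNN {m n : ℕ} (σ : ℝ → ℝ) (f : (Fin m → ℝ) → (Fin n → ℝ)) : Prop :=
  ∃ (s : ℕ) (A₁ : Matrix (Fin s) (Fin m) ℝ) (b₁ : Fin s → ℝ) (A₂ : Matrix (Fin n) (Fin s) ℝ)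
    (b₂ : Fin n → ℝ), ∀ x, f x = fnnLayer id A₂ b₂ (fnnLayer σ A₁ b₁ x)

/-- A GNN layer with linear message functions, summation as aggregation, and a combination
function computed by an FNN of depth 2 with activation function `σ`. -/
def GNNLayer.IsNeural {R : Type} {p q : ℕ} (σ : ℝ → ℝ) (L : GNNLayer R p q) : Prop :=
  ∃ (m : ℕ) (Wout Win : R → Matrix (Fin m) (Fin p) ℝ)
    (comb : (Fin (p + m) → ℝ) → (Fin q → ℝ)), IsDepthTwoFNN σ comb ∧
    L = { msgDim := m
          aggDim := m
          msgOut := fun r x => (Wout r).mulVec x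
          msgIn := fun r x => (Win r).mulVec x
          agg := fun M => M.sum
          comb := comb }

/-- A recurrent GNN whose layer is as above and whose readout function is computed by an FNN of
depth 2 with activation function `σ`. -/
def RecurrentGNN.IsNeural {R U : Type} [Fintype R] [Fintype U] {s : ℕ} (σ : ℝ → ℝ)
    (N : RecurrentGNN R U (Fin s → ℝ)) : Prop :=
  N.layer.IsNeural σ ∧ IsDepthTwoFNN σ N.readout

end

noncomputable section

/-! The multiset of values over all `v[w/i]` is the multiset over the `E_i`-neighbours of `v`
together with `v` itself (`LabelledGraph.map_tupleStructure_neighbours`). A WL round and a layer on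
`A_G` therefore see the same data, and induction on the layers gives the first half. For the
converse, only finitely many colours occur up to round `n` on graphs of order at most `n`, so each
can be given its own coordinate and stored as a unit vector. Summing unit vectors over
`E_i`-neighbours yields a histogram, which determines the multiset of colours. The combination
function then only has to send finitely many distinct points to prescribed unit vectors. A depth-2
network with continuous non-polynomial `σ` can do so (`exists_isDepthTwoFNN_interpolating`): a
linear relation among the ridge functions at the nodes would force iterated differences of `σ` to
vanish, making `σ` a polynomial. -/

/-! ### Interpolation by depth-2 networks -/

/-- Nodes are eliminated one at a time, each at the price of one difference of `g`. The `f i` are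
arbitrary so that differencing keeps the relation in the same form. -/
theorem fwdDiff_iter_eq_zero_of_ridge_sum_eq_zero {ι : Type*} {m : ℕ} (x : ι → Fin m → ℝ)
    (x₀ : Fin m → ℝ) (s : Finset ι) :
    ∀ (f : ι → ℝ → ℝ) (g : ℝ → ℝ), (∀ i ∈ s, x i ≠ x₀) →
      (∀ (w : Fin m → ℝ) (b : ℝ), g (w ⬝ᵥ x₀ + b) + ∑ i ∈ s, f i (w ⬝ᵥ x i + b) = 0) →
      ∀ h y : ℝ, (fwdDiff h)^[s.card] g y = 0 := by
  classical
  induction s using Finset.induction_on with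
  | empty =>
    intro f g _ hfg h y
    simpa using hfg 0 y
  | insert a s ha ih =>
    intro f g hx hfg h y
    rw [Finset.card_insert_of_notMem ha, Function.iterate_succ_apply]
    set d : Fin m → ℝ := x₀ - x a with hd
    have hd0 : d ⬝ᵥ d ≠ 0 := by
      rw [Ne, dotProduct_self_eq_zero, hd, sub_eq_zero]
      exact (hx a (Finset.mem_insert_self a s)).symm
    set r : ℝ := h / (d ⬝ᵥ d) with hr
    refine ih (fun i y => f i (y + r * (d ⬝ᵥ (x i - x a))) - f i y) (fwdDiff h g)
      (fun i hi => hx i (Finset.mem_insert_of_mem hi)) (fun w b => ?_) h y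
    -- This shift of `(w, b)` fixes the argument at `x a` and moves the one at `x₀` by exactly `h`;
    -- subtracting the two relations cancels the term of `a`.
    have h1 := hfg (w + r • d) (b - r * (d ⬝ᵥ x a))
    have h2 := hfg w b
    rw [Finset.sum_insert ha] at h1 h2
    have e : ∀ z, (w + r • d) ⬝ᵥ z + (b - r * (d ⬝ᵥ x a)) =
        w ⬝ᵥ z + b + r * (d ⬝ᵥ (z - x a)) := by
      intro z
      rw [add_dotProduct, smul_dotProduct, dotProduct_sub, smul_eq_mul]
      ring
    simp only [e] at h1
    rw [← hd, sub_self, dotProduct_zero, mul_zero, add_zero,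
      show r * (d ⬝ᵥ d) = h from div_mul_cancel₀ h hd0] at h1
    rw [Finset.sum_sub_distrib, fwdDiff]
    linarith

/-- Newton's forward difference formula, whose terms of order at least `N` vanish; the binomial
coefficients become polynomials through `descPochhammer`. -/
theorem exists_polynomial_eval_eq_on_progression {σ : ℝ → ℝ} {N : ℕ} {h : ℝ} (hh : h ≠ 0)
    (hσ : ∀ y, (fwdDiff h)^[N] σ y = 0) (y : ℝ) :
    ∃ Q : Polynomial ℝ, ∀ n : ℕ, σ (y + n * h) = Q.eval (y + n * h) := by
  have hz : ∀ k, N ≤ k → (fwdDiff h)^[k] σ y = 0 := by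
    intro k hk
    obtain ⟨j, rfl⟩ := Nat.exists_eq_add_of_le' hk
    rw [Function.iterate_add_apply, show (fwdDiff h)^[N] σ = fun _ => 0 from funext hσ]
    clear hk
    have : ∀ j, (fwdDiff h)^[j] (fun _ : ℝ => (0 : ℝ)) = fun _ => 0 := by
      intro j
      induction j with
      | zero => rfl
      | succ j ih => rw [Function.iterate_succ_apply', ih]; funext z; simp [fwdDiff]
    rw [this]
  refine ⟨∑ k ∈ Finset.range N, Polynomial.C ((fwdDiff h)^[k] σ y / k.factorial) *
    (descPochhammer ℝ k).comp (Polynomial.C h⁻¹ * (Polynomial.X - Polynomial.C y)), fun n => ?_⟩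
  have e : h⁻¹ * (y + n * h - y) = n := by field_simp; ring
  rw [← nsmul_eq_mul, shift_eq_sum_fwdDiff_iter h σ n y, nsmul_eq_mul]
  simp only [Polynomial.eval_finsetSum, Polynomial.eval_mul, Polynomial.eval_C,
    Polynomial.eval_comp, Polynomial.eval_sub, Polynomial.eval_X, e,
    descPochhammer_eval_eq_descFactorial, Nat.descFactorial_eq_factorial_mul_choose]
  have h1 : ∀ k, (n.choose k) • (fwdDiff h)^[k] σ y =
      (fwdDiff h)^[k] σ y / k.factorial * ((k.factorial * n.choose k : ℕ) : ℝ) := by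
    intro k
    have : (k.factorial : ℝ) ≠ 0 := by positivity
    push_cast
    rw [nsmul_eq_mul]
    field_simp
  rw [← Finset.sum_congr rfl fun k _ => h1 k]
  -- The two ranges differ only in terms that are zero, either by the vanishing differences or
  -- because the binomial coefficient is zero.
  rcases le_total N (n + 1) with hN | hN
  · symm
    refine Finset.sum_subset (Finset.range_mono hN) fun k _ hk => ?_
    rw [hz k (by simpa using hk), smul_zero]
  · refine Finset.sum_subset (Finset.range_mono hN) fun k _ hk => ?_
    rw [Nat.choose_eq_zero_of_lt (by simpa using hk), zero_smul]

/-- Fréchet's characterization of polynomials, for continuous functions. -/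
theorem Continuous.exists_polynomial_of_fwdDiff_iter_eq_zero {σ : ℝ → ℝ} (hc : Continuous σ)
    {N : ℕ} (hσ : ∀ h y, (fwdDiff h)^[N] σ y = 0) :
    ∃ P : Polynomial ℝ, ∀ x, σ x = P.eval x := by
  obtain ⟨P, hP⟩ := exists_polynomial_eval_eq_on_progression one_ne_zero (hσ 1) 0
  simp only [zero_add, mul_one] at hP
  refine ⟨P, fun x => ?_⟩
  refine congrFun (Continuous.ext_on Rat.denseRange_cast hc P.continuous ?_) x
  rintro _ ⟨r, rfl⟩
  have hq : (r.den : ℝ) ≠ 0 := by exact_mod_cast r.den_ne_zero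
  set M : ℕ := r.num.natAbs
  -- The progression from `-M` with step `1 / r.den` contains every natural number, which forces `Q
  -- = P`, and also `r`, since `-M ≤ r`.
  obtain ⟨Q, hQ⟩ := exists_polynomial_eval_eq_on_progression (inv_ne_zero hq)
    (hσ (r.den : ℝ)⁻¹) (-(M : ℝ))
  have hPQ : Q = P := by
    refine Polynomial.eq_of_infinite_eval_eq _ _ ((Set.infinite_range_of_injective
      (Nat.cast_injective (R := ℝ))).mono ?_)
    rintro _ ⟨j, rfl⟩
    have := hQ ((j + M) * r.den)
    rw [show -(M : ℝ) + (((j + M) * r.den : ℕ) : ℝ) * (r.den : ℝ)⁻¹ = j by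
      push_cast; field_simp; ring] at this
    exact this.symm.trans (hP j)
  have hnn : 0 ≤ r.num + M * r.den := by
    have h1 : (1 : ℤ) ≤ r.den := by exact_mod_cast r.den_pos
    have h2 : -(M : ℤ) ≤ r.num := by omega
    nlinarith [Int.natCast_nonneg M]
  obtain ⟨a, ha⟩ := Int.eq_ofNat_of_zero_le hnn
  have := hQ a
  have ha' : (a : ℝ) = r.num + M * r.den := by exact_mod_cast ha.symm
  rw [ha', hPQ, show -(M : ℝ) + (r.num + M * r.den) * (r.den : ℝ)⁻¹ = (r : ℝ) by
    rw [Rat.cast_def]; field_simp; ring] at this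
  exact this

/-- A nonzero functional killing a proper span has a nonzero coefficient at some node `j`; isolating
that node makes a nonzero multiple of `σ` a polynomial. -/
theorem span_ridge_eq_top {σ : ℝ → ℝ} (hc : Continuous σ)
    (hp : ¬ ∃ P : Polynomial ℝ, ∀ x, σ x = P.eval x) {ι : Type*} [Fintype ι] {m : ℕ}
    {x : ι → Fin m → ℝ} (hx : Function.Injective x) :
    Submodule.span ℝ (Set.range fun (c : (Fin m → ℝ) × ℝ) (i : ι) => σ (c.1 ⬝ᵥ x i + c.2)) = ⊤ := by
  classical
  by_contra hne
  obtain ⟨φ, hφ, hle⟩ := Submodule.exists_le_ker_of_lt_top _ (lt_top_iff_ne_top.2 hne)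
  obtain ⟨j, hj⟩ : ∃ j, φ (Pi.single j 1) ≠ 0 := by
    by_contra! h
    exact hφ (LinearMap.pi_ext' fun i => LinearMap.ext_ring (by simpa using h i))
  have hsum : ∀ (w : Fin m → ℝ) (b : ℝ), φ (Pi.single j 1) * σ (w ⬝ᵥ x j + b) +
      ∑ i ∈ Finset.univ.erase j, φ (Pi.single i 1) * σ (w ⬝ᵥ x i + b) = 0 := by
    intro w b
    have h := hle (Submodule.subset_span ⟨(w, b), rfl⟩)
    rw [LinearMap.mem_ker, LinearMap.pi_apply_eq_sum_univ] at h
    rw [Finset.add_sum_erase _ (fun i => φ (Pi.single i 1) * σ (w ⬝ᵥ x i + b))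
      (Finset.mem_univ j), ← h]
    refine Finset.sum_congr rfl fun i _ => ?_
    rw [smul_eq_mul, mul_comm]
    congr 2
    funext l
    simp [Pi.single_apply, eq_comm]
  obtain ⟨P, hP⟩ := Continuous.exists_polynomial_of_fwdDiff_iter_eq_zero
    (σ := fun y => φ (Pi.single j 1) * σ y) (continuous_const.mul hc)
    (fwdDiff_iter_eq_zero_of_ridge_sum_eq_zero x (x j) (Finset.univ.erase j)
      (fun i y => φ (Pi.single i 1) * σ y) _ (fun i hi h => Finset.ne_of_mem_erase hi (hx h)) hsum)
  exact hp ⟨Polynomial.C (φ (Pi.single j 1))⁻¹ * P, fun y => by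
    rw [Polynomial.eval_mul, Polynomial.eval_C, ← hP, inv_mul_cancel_left₀ hj]⟩

theorem exists_isDepthTwoFNN_interpolating {σ : ℝ → ℝ} (hc : Continuous σ)
    (hp : ¬ ∃ P : Polynomial ℝ, ∀ x, σ x = P.eval x) {ι : Type*} [Finite ι] {m n : ℕ}
    {x : ι → Fin m → ℝ} (hx : Function.Injective x) (y : ι → Fin n → ℝ) :
    ∃ f : (Fin m → ℝ) → (Fin n → ℝ), IsDepthTwoFNN σ f ∧ ∀ i, f (x i) = y i := by
  classical
  have := Fintype.ofFinite ι
  have hmem : ∀ a : Fin n, ∃ c : ((Fin m → ℝ) × ℝ) →₀ ℝ,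
      (c.sum fun p r => r • fun i : ι => σ (p.1 ⬝ᵥ x i + p.2)) = fun i => y i a := by
    intro a
    rw [← Finsupp.mem_span_range_iff_exists_finsupp, span_ridge_eq_top hc hp hx]
    trivial
  choose c hcy using hmem
  -- One hidden layer serves all output coordinates: its units are all the pairs (weight, bias) used
  -- by any of them.
  let T : Finset ((Fin m → ℝ) × ℝ) := Finset.univ.biUnion fun a => (c a).support
  let e := T.equivFin
  let A₁ : Matrix (Fin T.card) (Fin m) ℝ := fun j => (e.symm j).1.1
  let b₁ : Fin T.card → ℝ := fun j => (e.symm j).1.2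
  let A₂ : Matrix (Fin n) (Fin T.card) ℝ := fun a j => c a (e.symm j).1
  refine ⟨fun x => fnnLayer id A₂ 0 (fnnLayer σ A₁ b₁ x),
    ⟨T.card, A₁, b₁, A₂, 0, fun _ => rfl⟩, fun i => funext fun a => ?_⟩
  have h := congrFun (hcy a) i
  rw [Finsupp.sum_of_support_subset (s := T) _
    (Finset.subset_biUnion_of_mem (fun a => (c a).support) (Finset.mem_univ a)) _
    (by simp), Finset.sum_apply, ← Finset.sum_coe_sort, ← e.symm.sum_comp] at h
  rw [← h]
  simp [fnnLayer, Matrix.mulVec, dotProduct, A₁, A₂, b₁]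

/-! ### Oblivious `k`-WL refines every `k`-GNN -/

theorem Multiset.map_eq_map_of_map_eq_map {α β γ δ : Type*} {s : Multiset α} {t : Multiset β}
    {f : α → γ} {g : β → γ} {f' : α → δ} {g' : β → δ} (h : s.map f = t.map g)
    (hfg : ∀ a ∈ s, ∀ b ∈ t, f a = g b → f' a = g' b) : s.map f' = t.map g' := by
  rw [← Multiset.rel_eq, Multiset.rel_map] at h ⊢
  exact h.mono hfg

open Classical in
-- Substituting `a = v i` returns `v`, the one substitution that `E_i` excludes.
theorem LabelledGraph.map_tupleStructure_neighbours {k ℓ : ℕ} {V : Type u} [Fintype V]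
    (G : LabelledGraph ℓ V) {Z : Type*} (f : (Fin k → V) → Z) (i : Fin k) (v : Fin k → V) :
    f v ::ₘ (Finset.univ.filter fun y => (G.tupleStructure k).rel i v y).val.map f =
      (Finset.univ : Finset V).val.map fun a => f (Function.update v i a) := by
  have h : (Finset.univ.filter fun y => (G.tupleStructure k).rel i v y) =
      ((Finset.univ.erase (v i)).map ⟨Function.update v i, Function.update_injective v i⟩) := by
    ext y
    simp only [Finset.mem_filter_univ, Finset.mem_map, Finset.mem_erase, Finset.mem_univ, and_true,
      Function.Embedding.coeFn_mk]
    unfold LabelledGraph.tupleStructure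
    constructor
    · rintro ⟨h1, h2⟩
      refine ⟨y i, Ne.symm h1, ?_⟩
      rw [Function.update_eq_iff]
      exact ⟨rfl, fun j hj => h2 j hj⟩
    · rintro ⟨a, ha, rfl⟩
      exact ⟨by simpa using ha.symm, fun j hj => by simp [hj]⟩
  conv_rhs => rw [← Finset.insert_erase (Finset.mem_univ (v i)),
    Finset.insert_val_of_notMem (Finset.notMem_erase _ _), Multiset.map_cons,
    Function.update_eq_self]
  rw [h, Finset.map_val, Multiset.map_map]
  rfl

theorem LabelledGraph.tupleStructure_rel_comm {k ℓ : ℕ} {V : Type u} (G : LabelledGraph ℓ V)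
    (i : Fin k) (v y : Fin k → V) :
    (G.tupleStructure k).rel i y v ↔ (G.tupleStructure k).rel i v y :=
  and_congr ne_comm (forall₂_congr fun _ _ => eq_comm)

open Classical in
theorem LabelledGraph.col_tupleStructure_eq {k ℓ : ℕ} {V V' : Type u} {G : LabelledGraph ℓ V}
    {G' : LabelledGraph ℓ V'} {v : Fin k → V} {v' : Fin k → V'} (h : G.atp v = G'.atp v') :
    (G.tupleStructure k).col v = (G'.tupleStructure k).col v' := by
  funext c
  cases c with
  | inl r => exact if_congr (by simp [LabelledGraph.tupleStructure]) rfl rfl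
  | inr θ => exact if_congr (by simp [LabelledGraph.tupleStructure, h]) rfl rfl

open Classical in
theorem KGNN.feature_eq_of_owl_eq {k ℓ d : ℕ} {Y : Type w} (N : KGNN k ℓ d Y) {V V' : Type u}
    [Fintype V] [Fintype V'] (G : LabelledGraph ℓ V) (G' : LabelledGraph ℓ V') (t : Fin (d + 1)) :
    ∀ (v : Fin k → V) (v' : Fin k → V'), G.owl t v = G'.owl t v' →
      N.feature (G.tupleStructure k) t v = N.feature (G'.tupleStructure k) t v' := by
  induction t using Fin.induction with
  | zero =>
    intro v v' h
    change (G.tupleStructure k).initialFeature _ v = (G'.tupleStructure k).initialFeature _ v'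
    unfold BinaryStructure.initialFeature
    rw [LabelledGraph.col_tupleStructure_eq (show G.atp v = G'.atp v' from h)]
  | succ i ih =>
    intro v v' h
    have h1 : G.owl i v = G'.owl i v' := congrArg Prod.fst h
    have h2 := congrArg Prod.snd h
    have hζ := ih v v' h1
    change (N.layer i).apply (G.tupleStructure k) (N.feature (G.tupleStructure k) i.castSucc) v =
      (N.layer i).apply (G'.tupleStructure k) (N.feature (G'.tupleStructure k) i.castSucc) v'
    have key : ∀ {m : ℕ} (g : (Fin (N.dim i.castSucc) → ℝ) → Fin m → ℝ) (r : Fin k),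
        (Finset.univ.filter fun y => (G.tupleStructure k).rel r v y).val.map
            (fun y => g (N.feature (G.tupleStructure k) i.castSucc y)) =
          (Finset.univ.filter fun y => (G'.tupleStructure k).rel r v' y).val.map
            (fun y => g (N.feature (G'.tupleStructure k) i.castSucc y)) := by
      intro m g r
      have e1 := G.map_tupleStructure_neighbours
        (fun y => g (N.feature (G.tupleStructure k) i.castSucc y)) r v
      have e2 := G'.map_tupleStructure_neighbours
        (fun y => g (N.feature (G'.tupleStructure k) i.castSucc y)) r v'
      have e3 : ((Finset.univ : Finset V).val.map fun a => G.owl i (Function.update v r a)) =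
        (Finset.univ : Finset V').val.map fun a => G'.owl i (Function.update v' r a) :=
        congrFun h2 r
      -- Both sides become full substitution multisets; the summands of `v` and `v'` agree by `hζ`
      -- and are cancelled.
      rw [Multiset.map_eq_map_of_map_eq_map e3
        (fun a _ b _ hab => congrArg g (ih _ _ hab)), ← e2, hζ] at e1
      exact (Multiset.cons_inj_right _).1 e1
    have hm : (N.layer i).messages (G.tupleStructure k) (N.feature (G.tupleStructure k) i.castSucc) v =
        (N.layer i).messages (G'.tupleStructure k) (N.feature (G'.tupleStructure k) i.castSucc) v' := by
      unfold GNNLayer.messages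
      simp only [LabelledGraph.tupleStructure_rel_comm, key]
    simp only [GNNLayer.apply, hm, hζ]

theorem owlInvariant_refines_kGNN {k ℓ d : ℕ} {Y : Type w} (N : KGNN k ℓ d Y) :
    (owlInvariant.{u} k ℓ d).Refines (KGNN.invariant.{u} N) := by
  intro V V' _ _ G G' v v' h
  exact congrArg N.readout (N.feature_eq_of_owl_eq G G' (Fin.last d) v v' h)

/-! ### Finitely many colours and their encoding by vectors -/

/-- All these multisets lie below `n` copies of `S`, and such an order interval is finite. -/
theorem Multiset.finite_setOf_forall_mem_and_card_le {α : Type*} {S : Set α} (hS : S.Finite)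
    (n : ℕ) : {M : Multiset α | (∀ a ∈ M, a ∈ S) ∧ M.card ≤ n}.Finite := by
  classical
  refine (Set.finite_Iic (n • hS.toFinset.val)).subset fun M hM => ?_
  refine Multiset.le_iff_count.2 fun a => ?_
  by_cases ha : a ∈ M
  · rw [Multiset.count_nsmul, Multiset.count_eq_one_of_mem hS.toFinset.nodup
      (hS.mem_toFinset.2 (hM.1 a ha)), mul_one]
    exact (Multiset.count_le_card a M).trans hM.2
  · rw [Multiset.count_eq_zero_of_notMem ha]
    exact Nat.zero_le _

theorem single_one_injective {κ : Type*} [DecidableEq κ] :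
    Function.Injective fun j : κ => (Pi.single j 1 : κ → ℝ) := by
  intro i j h
  by_contra hne
  simpa [hne] using congrFun h i

theorem Multiset.sum_map_single_one_apply {α κ : Type*} [DecidableEq κ] (M : Multiset α)
    (f : α → κ) (j : κ) :
    ((M.map fun a => (Pi.single (f a) 1 : κ → ℝ)).sum) j = (M.map f).count j := by
  induction M using Multiset.induction_on with
  | empty => simp
  | cons a M ih =>
    rw [Multiset.map_cons, Multiset.sum_cons, Pi.add_apply, ih, Multiset.map_cons,
      Multiset.count_cons, Pi.single_apply]
    split_ifs <;> push_cast <;> ring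

/-- The sum of unit vectors is the histogram of the indices, from which the multiset is recovered
wherever the indexing is injective. -/
theorem Multiset.eq_of_sum_map_single_one_eq {α κ : Type*} [DecidableEq κ] {M M' : Multiset α}
    {f : α → κ} (hf : ∀ a ∈ M, ∀ b ∈ M', f a = f b → a = b)
    (h : (M.map fun a => (Pi.single (f a) 1 : κ → ℝ)).sum =
      (M'.map fun a => (Pi.single (f a) 1 : κ → ℝ)).sum) : M = M' := by
  have h1 : M.map f = M'.map f := by
    refine Multiset.ext' fun j => ?_
    have := congrFun h j
    rw [Multiset.sum_map_single_one_apply, Multiset.sum_map_single_one_apply] at this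
    exact_mod_cast this
  simpa using Multiset.map_eq_map_of_map_eq_map (f' := id) (g' := id) h1 hf

/-- Colours of oblivious `k`-WL all of whose multisets have at most `n` elements. -/
def boundedOwlColours (k ℓ n : ℕ) : (t : ℕ) → Set (OwlColour k ℓ t)
  | 0 => Set.univ
  | t + 1 => {c | c.1 ∈ boundedOwlColours k ℓ n t ∧
      ∀ i, (∀ a ∈ c.2 i, a ∈ boundedOwlColours k ℓ n t) ∧ (c.2 i).card ≤ n}

theorem finite_boundedOwlColours (k ℓ n t : ℕ) : (boundedOwlColours k ℓ n t).Finite := by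
  induction t with
  | zero => exact Set.toFinite (Set.univ : Set (AtomicType k ℓ))
  | succ t ih =>
    exact (ih.prod (Set.Finite.pi fun _ : Fin k =>
      Multiset.finite_setOf_forall_mem_and_card_le ih n)).subset
        fun c hc => ⟨hc.1, fun i _ => hc.2 i⟩

theorem LabelledGraph.owl_mem_boundedOwlColours {k ℓ n : ℕ} {V : Type u} [Fintype V]
    (G : LabelledGraph ℓ V) (hV : Fintype.card V ≤ n) (t : ℕ) :
    ∀ v : Fin k → V, G.owl t v ∈ boundedOwlColours k ℓ n t := by
  induction t with
  | zero => exact fun _ => trivial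
  | succ t ih =>
    intro v
    refine ⟨ih v, fun i => ⟨fun a ha => ?_, ?_⟩⟩
    · obtain ⟨w, _, rfl⟩ := Multiset.mem_map.1 ha
      exact ih _
    · change (Multiset.map _ _).card ≤ n
      rwa [Multiset.card_map]

/-- The colours that occur in the first `n` rounds on graphs of order at most `n`. -/
def boundedOwlColoursUpTo (k ℓ n : ℕ) : Set (Σ t, OwlColour k ℓ t) :=
  {c | c.1 ≤ n ∧ c.2 ∈ boundedOwlColours k ℓ n c.1}

theorem finite_boundedOwlColoursUpTo (k ℓ n : ℕ) : (boundedOwlColoursUpTo k ℓ n).Finite := by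
  refine ((Set.finite_Iic n).biUnion fun t _ =>
    (finite_boundedOwlColours k ℓ n t).image (Sigma.mk t)).subset ?_
  rintro ⟨t, c⟩ ⟨ht, hc⟩
  exact Set.mem_biUnion (x := t) ht ⟨c, hc, rfl⟩

/-- The initial feature dictates the coordinates of the atomic types; later colours get fresh ones.
Rounds are indexed jointly, so that a recurrent layer needs no separate clock. -/
theorem exists_owlColour_index (k ℓ n : ℕ) :
    ∃ (p : ℕ) (_ : Fintype.card (Fin k ⊕ AtomicType k ℓ) ≤ p)
      (idx : (Σ t, OwlColour k ℓ t) → Fin p),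
      (∀ θ : AtomicType k ℓ, (idx ⟨0, θ⟩ : ℕ) =
        Fintype.equivFin (Fin k ⊕ AtomicType k ℓ) (Sum.inr θ)) ∧
      Set.InjOn idx (boundedOwlColoursUpTo k ℓ n) := by
  classical
  have := (finite_boundedOwlColoursUpTo k ℓ n).to_subtype
  set q := Fintype.card (Fin k ⊕ AtomicType k ℓ)
  let e := Finite.equivFin (boundedOwlColoursUpTo k ℓ n)
  let idx : (Σ t, OwlColour k ℓ t) → Fin (q + (Nat.card (boundedOwlColoursUpTo k ℓ n) + 1))
    | ⟨0, θ⟩ => Fin.castAdd _ (Fintype.equivFin (Fin k ⊕ AtomicType k ℓ) (Sum.inr θ))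
    -- The extra last coordinate is a junk value for colours outside the bounded set.
    | ⟨t + 1, c⟩ => Fin.natAdd q (if h : ⟨t + 1, c⟩ ∈ boundedOwlColoursUpTo k ℓ n then
        (e ⟨_, h⟩).castSucc else Fin.last _)
  refine ⟨_, Nat.le_add_right q _, idx, fun θ => rfl, ?_⟩
  rintro ⟨t, c⟩ hc ⟨t', c'⟩ hc' h
  match t, t', c, c', hc, hc', h with
  | 0, 0, c, c', hc, hc', h =>
    have h1 := (Fintype.equivFin (Fin k ⊕ AtomicType k ℓ)).injective (Fin.castAdd_injective _ _ h)
    rw [Sum.inr.inj h1]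
  | 0, t' + 1, c, c', hc, hc', h =>
    have h1 := congrArg Fin.val h
    simp only [idx, Fin.val_castAdd, Fin.val_natAdd] at h1
    omega
  | t + 1, 0, c, c', hc, hc', h =>
    have h1 := congrArg Fin.val h
    simp only [idx, Fin.val_castAdd, Fin.val_natAdd] at h1
    omega
  | t + 1, t' + 1, c, c', hc, hc', h =>
    simp only [idx, dif_pos hc, dif_pos hc'] at h
    exact congrArg Subtype.val (e.injective (Fin.castSucc_injective _ (Fin.natAdd_injective _ _ h)))

/-- The input of the combination function that encodes a colour of round `t + 1`: the one-hot
encoding of the previous colour and, for each position, the histogram of the colours of the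
neighbours. -/
def owlColourCode {k ℓ p : ℕ} (idx : (Σ t, OwlColour k ℓ t) → Fin p) (t : ℕ)
    (c : OwlColour k ℓ (t + 1)) : Fin (p + k * p) → ℝ :=
  Fin.append (Pi.single (idx ⟨t, c.1⟩) 1) fun j =>
    ((c.2 (finProdFinEquiv.symm j).1).map fun a => (Pi.single (idx ⟨t, a⟩) 1 : Fin p → ℝ)).sum
      (finProdFinEquiv.symm j).2 -
    -- The subtraction removes `v` itself, which is not its own `E_i`-neighbour.
    (Pi.single (idx ⟨t, c.1⟩) 1 : Fin p → ℝ) (finProdFinEquiv.symm j).2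

/-- The first block reveals the round and the previous colour; the subtracted unit vector is then
known, and the histograms give back the multisets. -/
theorem owlColourCode_injective {k ℓ p n : ℕ} {idx : (Σ t, OwlColour k ℓ t) → Fin p}
    (hidx : Set.InjOn idx (boundedOwlColoursUpTo k ℓ n)) {t t' : ℕ} (ht : t ≤ n) (ht' : t' ≤ n)
    {c : OwlColour k ℓ (t + 1)} {c' : OwlColour k ℓ (t' + 1)}
    (hc : c ∈ boundedOwlColours k ℓ n (t + 1)) (hc' : c' ∈ boundedOwlColours k ℓ n (t' + 1))
    (h : owlColourCode idx t c = owlColourCode idx t' c') :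
    (⟨t + 1, c⟩ : Σ t, OwlColour k ℓ t) = ⟨t' + 1, c'⟩ := by
  have h1 : (Pi.single (idx ⟨t, c.1⟩) 1 : Fin p → ℝ) = Pi.single (idx ⟨t', c'.1⟩) 1 := by
    funext j
    simpa [owlColourCode] using congrFun h (Fin.castAdd _ j)
  have h3 := hidx ⟨ht, hc.1⟩ ⟨ht', hc'.1⟩ (single_one_injective h1)
  obtain rfl : t = t' := congrArg Sigma.fst h3
  have h4 : c.1 = c'.1 := by simpa using h3
  have h5 : c.2 = c'.2 := by
    funext i
    refine Multiset.eq_of_sum_map_single_one_eq (f := fun a => idx ⟨t, a⟩)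
      (fun a ha b hb hab => ?_) (funext fun l => ?_)
    · simpa using hidx ⟨ht, (hc.2 i).1 a ha⟩ ⟨ht', (hc'.2 i).1 b hb⟩ hab
    · have := congrFun h (Fin.natAdd _ (finProdFinEquiv (i, l)))
      simpa only [owlColourCode, Fin.append_right, Equiv.symm_apply_apply, h4, sub_left_inj]
        using this
  rw [show c = c' from Prod.ext h4 h5]

/-! ### The recurrent layer that simulates a WL round -/

/-- The matrix that embeds a vector as the `r`-th of `k` blocks. -/
def blockEmbedding {k : ℕ} (p : ℕ) (r : Fin k) : Matrix (Fin (k * p)) (Fin p) ℝ :=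
  fun j l => if finProdFinEquiv.symm j = (r, l) then 1 else 0

theorem blockEmbedding_mulVec_apply {k p : ℕ} (r : Fin k) (x : Fin p → ℝ) (j : Fin (k * p)) :
    (blockEmbedding p r).mulVec x j =
      if r = (finProdFinEquiv.symm j).1 then x (finProdFinEquiv.symm j).2 else 0 := by
  obtain ⟨⟨i, l⟩, rfl⟩ := finProdFinEquiv.surjective j
  by_cases h : r = i
  · subst h; simp [blockEmbedding, Matrix.mulVec, dotProduct]
  · simp [blockEmbedding, Matrix.mulVec, dotProduct, h, Ne.symm h]

/-- The layer that sums up, separately for every relation, the features of the neighbours. -/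
def histogramLayer {k p : ℕ} (comb : (Fin (p + k * p) → ℝ) → (Fin p → ℝ)) :
    GNNLayer (Fin k) p p where
  msgDim := k * p
  aggDim := k * p
  msgOut r x := (blockEmbedding p r).mulVec x
  -- On `A_G` the relations are symmetric, so incoming edges would only repeat the outgoing
  -- messages.
  msgIn _ x := (0 : Matrix (Fin (k * p)) (Fin p) ℝ).mulVec x
  agg M := M.sum
  comb := comb

open Classical in
theorem histogramLayer_messages_sum_apply {k p : ℕ} (comb : (Fin (p + k * p) → ℝ) → (Fin p → ℝ))
    {U : Type} {X : Type u} [Fintype X] (A : BinaryStructure (Fin k) U X) (ζ : X → Fin p → ℝ)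
    (x : X) (j : Fin (k * p)) :
    ((histogramLayer comb).messages A ζ x).sum j =
      ∑ y ∈ Finset.univ.filter (fun y => A.rel (finProdFinEquiv.symm j).1 x y),
        ζ y (finProdFinEquiv.symm j).2 := by
  have h : ((histogramLayer comb).messages A ζ x).sum =
      ∑ r : Fin k, (∑ y ∈ Finset.univ.filter (fun y => A.rel r x y),
        (blockEmbedding p r).mulVec (ζ y) +
        ∑ y ∈ Finset.univ.filter (fun y => A.rel r y x),
          (0 : Matrix (Fin (k * p)) (Fin p) ℝ).mulVec (ζ y)) := by
    unfold GNNLayer.messages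
    rw [← Multiset.coe_sumAddMonoidHom, map_sum]
    exact Finset.sum_congr rfl fun r _ => map_add _ _ _
  rw [h]
  simp only [Matrix.zero_mulVec, Finset.sum_const_zero, add_zero, Finset.sum_apply,
    blockEmbedding_mulVec_apply]
  rw [Finset.sum_eq_single (finProdFinEquiv.symm j).1]
  · simp
  · intro r _ hr
    simp only [if_neg hr, Finset.sum_const_zero]
  · simp

theorem histogramLayer_apply_eq {k ℓ p t : ℕ} (comb : (Fin (p + k * p) → ℝ) → (Fin p → ℝ))
    (idx : (Σ t, OwlColour k ℓ t) → Fin p) {V : Type u} [Fintype V] (G : LabelledGraph ℓ V)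
    {ζ : (Fin k → V) → Fin p → ℝ} (hζ : ∀ v, ζ v = Pi.single (idx ⟨t, G.owl t v⟩) 1)
    (v : Fin k → V) :
    (histogramLayer comb).apply (G.tupleStructure k) ζ v =
      comb (owlColourCode idx t (G.owl (t + 1) v)) := by
  classical
  unfold GNNLayer.apply owlColourCode
  refine congrArg comb ?_
  change Fin.append (ζ v) ((histogramLayer comb).messages (G.tupleStructure k) ζ v).sum = _
  rw [hζ v]
  refine congrArg (Fin.append _) (funext fun j => ?_)
  refine (histogramLayer_messages_sum_apply comb _ ζ v j).trans ?_
  have h := congrArg (fun M => M.sum (finProdFinEquiv.symm j).2)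
    (G.map_tupleStructure_neighbours ζ (finProdFinEquiv.symm j).1 v)
  simp only [Multiset.sum_cons, Pi.add_apply] at h
  change _ = (((Finset.univ : Finset V).val.map fun w =>
      G.owl t (Function.update v (finProdFinEquiv.symm j).1 w)).map
      fun a => (Pi.single (idx ⟨t, a⟩) 1 : Fin p → ℝ)).sum (finProdFinEquiv.symm j).2 -
    (Pi.single (idx ⟨t, G.owl t v⟩) 1 : Fin p → ℝ) _
  rw [eq_sub_iff_add_eq', Multiset.map_map]
  simp only [Function.comp_def, ← hζ]
  rw [← h]
  congr 1
  exact (Finset.sum_apply _ _ _).symm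

/-- There are no loops, and exactly one atomic type holds for each tuple. -/
theorem LabelledGraph.initialFeature_tupleStructure {k ℓ p : ℕ}
    {idx : (Σ t, OwlColour k ℓ t) → Fin p}
    (hidx : ∀ θ : AtomicType k ℓ, (idx ⟨0, θ⟩ : ℕ) =
        Fintype.equivFin (Fin k ⊕ AtomicType k ℓ) (Sum.inr θ))
    {V : Type u} (G : LabelledGraph ℓ V) (v : Fin k → V) :
    (G.tupleStructure k).initialFeature p v = Pi.single (idx ⟨0, G.atp v⟩) 1 := by
  classical
  funext i
  unfold BinaryStructure.initialFeature
  have hi : i = idx ⟨0, G.atp v⟩ ↔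
      (i : ℕ) = Fintype.equivFin (Fin k ⊕ AtomicType k ℓ) (Sum.inr (G.atp v)) := by
    rw [Fin.ext_iff, ← hidx]
  rw [Pi.single_apply, if_congr hi rfl rfl]
  split_ifs with h1 h2 h2
  · have : (Fintype.equivFin (Fin k ⊕ AtomicType k ℓ)).symm ⟨i, h1⟩ = Sum.inr (G.atp v) := by
      rw [Equiv.symm_apply_eq]
      exact Fin.ext h2
    rw [this]
    simp [BinaryStructure.col, LabelledGraph.tupleStructure]
  · obtain ⟨c, hc⟩ : ∃ c, c = (Fintype.equivFin (Fin k ⊕ AtomicType k ℓ)).symm ⟨i, h1⟩ := ⟨_, rfl⟩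
    rw [← hc]
    cases c with
    | inl r => simp [BinaryStructure.col, LabelledGraph.tupleStructure]
    | inr θ =>
      refine if_neg fun hθ => h2 ?_
      rw [show G.atp v = θ from hθ, hc, Equiv.apply_symm_apply]
  · exact absurd (h2 ▸ Fin.is_lt _) h1
  · rfl

theorem exists_recurrentKGNN_refines_owl (k ℓ n : ℕ) {σ : ℝ → ℝ} (hc : Continuous σ)
    (hσ : ¬ ∃ P : Polynomial ℝ, ∀ x, σ x = P.eval x) :
    ∃ (s : ℕ) (N : RecurrentKGNN k ℓ (Fin s → ℝ)), N.IsNeural σ ∧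
      ∀ t ≤ n, (RecurrentKGNN.invariant.{u} N t).RefinesUpToOrder n
        (owlInvariant.{u} k ℓ t) := by
  obtain ⟨p, hp, idx, hidx0, hidx⟩ := exists_owlColour_index k ℓ n
  -- The same combination function is applied in every round, so the codes of rounds `1` to `n` are
  -- interpolated together.
  let I := {c : Σ t, OwlColour k ℓ (t + 1) //
    (⟨c.1 + 1, c.2⟩ : Σ t, OwlColour k ℓ t) ∈ boundedOwlColoursUpTo k ℓ n}
  have := (finite_boundedOwlColoursUpTo k ℓ n).to_subtype
  have : Finite I := Finite.of_injective
    (fun c : I => (⟨_, c.2⟩ : boundedOwlColoursUpTo k ℓ n)) (by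
      rintro ⟨⟨t, c⟩, h⟩ ⟨⟨t', c'⟩, h'⟩ e
      have e := congrArg Subtype.val e
      obtain rfl : t = t' := Nat.succ.inj (congrArg Sigma.fst e)
      obtain rfl : c = c' := by simpa using e
      rfl)
  obtain ⟨comb, hcomb, hcomb'⟩ := exists_isDepthTwoFNN_interpolating hc hσ
    (x := fun c : I => owlColourCode idx c.1.1 c.1.2) (by
      rintro ⟨⟨t, c⟩, h⟩ ⟨⟨t', c'⟩, h'⟩ e
      have e := owlColourCode_injective hidx ((Nat.le_succ t).trans h.1)
        ((Nat.le_succ t').trans h'.1) h.2 h'.2 e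
      obtain rfl : t = t' := Nat.succ.inj (congrArg Sigma.fst e)
      obtain rfl : c = c' := by simpa using e
      rfl)
    (fun c => (Pi.single (idx ⟨c.1.1 + 1, c.1.2⟩) 1 : Fin p → ℝ))
  -- The readout has to be a network as well; it is chosen to fix all unit vectors.
  obtain ⟨read, hread, hread'⟩ := exists_isDepthTwoFNN_interpolating hc hσ
    (x := fun j : Fin p => (Pi.single j 1 : Fin p → ℝ)) single_one_injective
    (fun j => (Pi.single j 1 : Fin p → ℝ))
  let N : RecurrentKGNN k ℓ (Fin p → ℝ) := ⟨p, hp, histogramLayer comb, read⟩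
  have hfeat : ∀ {V : Type u} [Fintype V] (G : LabelledGraph ℓ V), Fintype.card V ≤ n →
      ∀ t ≤ n, ∀ v, N.feature (G.tupleStructure k) t v = Pi.single (idx ⟨t, G.owl t v⟩) 1 := by
    intro V _ G hV t
    induction t with
    | zero => exact fun _ v => G.initialFeature_tupleStructure hidx0 v
    | succ t ih =>
      intro ht v
      refine (histogramLayer_apply_eq comb idx G (ih (Nat.le_of_succ_le ht)) v).trans ?_
      exact hcomb' ⟨⟨t, G.owl (t + 1) v⟩, ht, G.owl_mem_boundedOwlColours hV (t + 1) v⟩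
  refine ⟨p, N, ⟨⟨k * p, blockEmbedding p, fun _ => 0, comb, hcomb, rfl⟩, hread⟩, ?_⟩
  intro t ht V V' _ _ G G' v v' hV hV' h
  change read (N.feature (G.tupleStructure k) t v) =
    read (N.feature (G'.tupleStructure k) t v') at h
  rw [hfeat G hV t ht, hfeat G' hV' t ht, hread', hread'] at h
  have e := hidx (x₁ := ⟨t, G.owl t v⟩) (x₂ := ⟨t, G'.owl t v'⟩)
    ⟨ht, G.owl_mem_boundedOwlColours hV t v⟩ ⟨ht, G'.owl_mem_boundedOwlColours hV' t v'⟩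
    (single_one_injective h)
  change G.owl t v = G'.owl t v'
  simpa using e

end

theorem mainTheorem9 (k ℓ : ℕ) (hk : 2 ≤ k) :
    (∀ (d : ℕ), 1 ≤ d → ∀ (Y : Type w) (N : KGNN k ℓ d Y),
      (owlInvariant.{u} k ℓ d).Refines (KGNN.invariant.{u} N)) ∧
    (∀ (n : ℕ), 1 ≤ n → ∀ (σ : ℝ → ℝ), Continuous σ →
      (¬ ∃ P : Polynomial ℝ, ∀ x, σ x = P.eval x) →
      ∃ (s : ℕ) (N : RecurrentKGNN k ℓ (Fin s → ℝ)), N.IsNeural σ ∧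
        ∀ t ≤ n, (RecurrentKGNN.invariant.{u} N t).RefinesUpToOrder n
          (owlInvariant.{u} k ℓ t)) := by
  exact ⟨fun _ _ _ N => owlInvariant_refines_kGNN N,
    fun n _ _ hc hσ => exists_recurrentKGNN_refines_owl k ℓ n hc hσ⟩
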